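/- Let $N$ be a number of servers, $K\ge 2$ a number of messages, and $L$ a message length; let $\mathcal X$, $\mathcal Y$ be finite alphabets, $\mathcal F$ a finite nonempty set of keys, and $\mathcal Q_0,\dots,\mathcal Q_{N-1}$ sets of queries. An $N$-server private information retrieval (PIR) code for $K$ messages $W_0,\dots,W_{K-1}\in\mathcal X^L$ consists of query functions $\phi_n:\{0,\dots,K-1\}\times\mathcal F\to\mathcal Q_n$, answer length functions $\ell_n:\mathcal Q_n\to\{0,1,2,\dots\}$, answer functions $\varphi_n(q,\cdot):(\mathcal X^{L})^K\to\mathcal Y^{\ell_n(q)}$ for $q\in\mathcal Q_n$ ($0\le n\le N-1$), and a reconstruction function $\psi$, such that * (correctness) $\psi\big((\varphi_n(\phi_n(k,f),W_{0:K-1}))_{0\le n\le N-1},k,f\big)=W_k$ for all $k$, all $f\in\mathcal F$ and all $W_{0:K-1}\in(\mathcal X^L)^K$; * (privacy) for $\mathsf F$ uniformly distributed on $\mathcal F$, $\Pr(\phi_n(k,\mathsf F)=q)=\Pr(\phi_n(k',\mathsf F)=q)$ for all $k,k'$, all $n$ and all $q\in\mathcal Q_n$. The message size is $L\log_2|\mathcal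 X|$ (in bits), and the retrieval rate is $$R=\frac{L\log_2|\mathcal X|}{\log_2|\mathcal Y|\,\sum_{n=0}^{N-1}\mathbb E\big[\ell_n(\phi_n(k,\mathsf F))\big]},$$ which by privacy does not depend on $k$. The code is capacity-achieving if the denominator is positive and $R=C$, where $C=\big(1+\frac1N+\dots+\frac1{N^{K-1}}\big)^{-1}$. The code is uniformly decomposable if $\mathcal Y$ is a finite abelian group and there are component functions $\varphi^{(q)}_{n,i,k}:\mathcal X^L\to\mathcal Y$ such that, for all $n$, all $q\in\mathcal Q_n$ and all $0\le i<\ell_n(q)$, the $i$-th symbol of $\varphi_n(q,W_{0:K-1})$ equals $\varphi^{(q)}_{n,i,0}(W_0)+\dots+\varphi^{(q)}_{n,i,K-1}(W_{K-1})$, and each $\varphi^{(q)}_{n,i,k}$ either takes every value of $\mathcal Y$ equally often on $\mathcal X^L$ or is constant. **Theorem 3 (minimum message size).** Every uniformly decomposable capacity-achieving PIR code with $K\ge 2$ messages satisfies $$L\log_2|\mathcal X|\;\ge\;(N-1)\log_2|\mathcal Y|,$$ and in particular $L\log_2|\mathcal X|\ge N-1$: the message size is at least $N-1$ bits. -/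

import Mathlib

open scoped BigOperators

/-- The probability that a random key, uniformly distributed on the finite set `𝓕`, lies in the
event `E`. -/
noncomputable def keyProb {𝓕 : Type*} [Fintype 𝓕] (E : Set 𝓕) : ℝ :=
  (E.ncard : ℝ) / (Fintype.card 𝓕 : ℝ)

/-- An `N`-server private information retrieval code for `K` messages, each consisting of `L`
symbols of the alphabet `𝒳`. The answers are vectors over the alphabet `𝒴`, the random key is
uniformly distributed on the finite set `𝓕`, and `𝒬 n` is the set of queries for server `n`. -/
structure PIRCode (N K L : ℕ) (𝒳 𝒴 𝓕 : Type*) [Fintype 𝓕] (𝒬 : Fin N → Type*) where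
  /-- The query sent to server `n` when message `k` is requested and the key is `f`. -/
  query : ∀ n : Fin N, Fin K → 𝓕 → 𝒬 n
  /-- The length of the answer of server `n` to the query `q`. -/
  len : ∀ n : Fin N, 𝒬 n → ℕ
  /-- The answer of server `n` to the query `q`, as a function of all the messages. -/
  answer : ∀ (n : Fin N) (q : 𝒬 n), (Fin K → Fin L → 𝒳) → Fin (len n q) → 𝒴
  /-- The reconstruction function. The user knows `k` and the key `f`, hence the queries and the
  lengths of the answers. -/
  reconstruct : ∀ (k : Fin K) (f : 𝓕),
    (∀ n : Fin N, Fin (len n (query n k f)) → 𝒴) → Fin L → 𝒳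
  /-- Correctness: the requested message is recovered, for every key and all message values. -/
  correct : ∀ (k : Fin K) (f : 𝓕) (W : Fin K → Fin L → 𝒳),
    reconstruct k f (fun n => answer n (query n k f) W) = W k
  /-- Privacy: the distribution of the query to each server does not depend on the index of the
  requested message. -/
  privacy : ∀ (k k' : Fin K) (n : Fin N) (q : 𝒬 n),
    keyProb {f : 𝓕 | query n k f = q} = keyProb {f : 𝓕 | query n k' f = q}

namespace PIRCode

variable {N K L : ℕ} {𝒳 𝒴 𝓕 : Type*} [Fintype 𝓕] {𝒬 : Fin N → Type*}

/-- The expected length `𝔼(ℓ_n)` of the answer of server `n` when message `k` is requested. -/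
noncomputable def expectedLength (C : PIRCode N K L 𝒳 𝒴 𝓕 𝒬) (k : Fin K) (n : Fin N) : ℝ :=
  (∑ f : 𝓕, (C.len n (C.query n k f) : ℝ)) / (Fintype.card 𝓕 : ℝ)

/-- The expected number of downloaded bits when message `k` is requested. -/
noncomputable def downloadCost [Fintype 𝒴] (C : PIRCode N K L 𝒳 𝒴 𝓕 𝒬) (k : Fin K) : ℝ :=
  Real.logb 2 (Fintype.card 𝒴 : ℝ) * ∑ n : Fin N, C.expectedLength k n

/-- The message size in bits, `L * log₂ |𝒳|`. -/
noncomputable def messageSize [Fintype 𝒳] (_C : PIRCode N K L 𝒳 𝒴 𝓕 𝒬) : ℝ :=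
  (L : ℝ) * Real.logb 2 (Fintype.card 𝒳 : ℝ)

/-- The retrieval rate: requested bits per expected downloaded bit. By privacy it does not depend
on the index `k` of the requested message, see `rate_eq_rate`. -/
noncomputable def rate [Fintype 𝒳] [Fintype 𝒴] (C : PIRCode N K L 𝒳 𝒴 𝓕 𝒬) (k : Fin K) : ℝ :=
  C.messageSize / C.downloadCost k

theorem expectedLength_eq_expectedLength (C : PIRCode N K L 𝒳 𝒴 𝓕 𝒬) (k k' : Fin K) (n : Fin N) :
    C.expectedLength k n = C.expectedLength k' n := by
  classical
  have key : ∀ (j : Fin K) (s : Finset (𝒬 n)), (∀ f, C.query n j f ∈ s) →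
      C.expectedLength j n =
        ∑ q ∈ s, keyProb {f : 𝓕 | C.query n j f = q} * (C.len n q : ℝ) := by
    intro j s hs
    unfold expectedLength
    rw [← Finset.sum_fiberwise_of_maps_to (fun f _ => hs f), Finset.sum_div]
    refine Finset.sum_congr rfl fun q _ => ?_
    have h1 : ∑ f : 𝓕 with C.query n j f = q, (C.len n (C.query n j f) : ℝ) =
        ∑ f : 𝓕 with C.query n j f = q, (C.len n q : ℝ) := by
      refine Finset.sum_congr rfl fun f hf => ?_
      rw [(Finset.mem_filter.mp hf).2]
    have h2 : {f : 𝓕 | C.query n j f = q}.ncard =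
        (Finset.univ.filter fun f : 𝓕 => C.query n j f = q).card := by
      rw [← Set.ncard_coe_finset]
      simp
    rw [h1, Finset.sum_const, nsmul_eq_mul, keyProb, h2]
    ring
  rw [key k (Finset.univ.image (C.query n k) ∪ Finset.univ.image (C.query n k')) (by simp),
    key k' (Finset.univ.image (C.query n k) ∪ Finset.univ.image (C.query n k')) (by simp)]
  simp only [C.privacy k k' n]

theorem rate_eq_rate [Fintype 𝒳] [Fintype 𝒴] (C : PIRCode N K L 𝒳 𝒴 𝓕 𝒬) (k k' : Fin K) :
    C.rate k = C.rate k' := by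
  simp only [rate, downloadCost, C.expectedLength_eq_expectedLength k k']

/-- The capacity `(1 + 1/N + ⋯ + 1/N^(K-1))⁻¹` of private information retrieval with `N` servers
and `K` messages. -/
noncomputable def capacity (N K : ℕ) : ℝ :=
  (∑ i ∈ Finset.range K, (1 / (N : ℝ)) ^ i)⁻¹

/-- The code is capacity-achieving: its rate is defined (something is downloaded) and equals the
capacity. -/
def IsCapacityAchieving [Fintype 𝒳] [Fintype 𝒴] (C : PIRCode N K L 𝒳 𝒴 𝓕 𝒬) : Prop :=
  ∀ k : Fin K, 0 < C.downloadCost k ∧ C.rate k = capacity N K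

/-- The family `g` of component functions decomposes the answers of the code: symbol `i` of the
answer of server `n` to the query `q` is the sum over `k` of `g n q i k (W k)`. -/
def IsDecomposition [AddCommGroup 𝒴] (C : PIRCode N K L 𝒳 𝒴 𝓕 𝒬)
    (g : ∀ (n : Fin N) (q : 𝒬 n), Fin (C.len n q) → Fin K → (Fin L → 𝒳) → 𝒴) : Prop :=
  ∀ (n : Fin N) (q : 𝒬 n) (W : Fin K → Fin L → 𝒳) (i : Fin (C.len n q)),
    C.answer n q W i = ∑ k : Fin K, g n q i k (W k)

/-- All the fibres of `h` have the same number of elements. -/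
def HasEqualFibres {α β : Type*} (h : α → β) : Prop :=
  ∀ y y' : β, {w : α | h w = y}.ncard = {w : α | h w = y'}.ncard

/-- The code is uniformly decomposable: it has a decomposition each of whose component functions
either takes every value equally often or is constant. (A decomposition is unique up to adding
constants to the component functions, so its choice does not matter.) -/
def IsUniformlyDecomposable [AddCommGroup 𝒴] (C : PIRCode N K L 𝒳 𝒴 𝓕 𝒬) : Prop :=
  ∃ g : ∀ (n : Fin N) (q : 𝒬 n), Fin (C.len n q) → Fin K → (Fin L → 𝒳) → 𝒴,
    C.IsDecomposition g ∧
      ∀ (n : Fin N) (q : 𝒬 n) (i : Fin (C.len n q)) (k : Fin K),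
        HasEqualFibres (g n q i k) ∨ ∀ w w' : Fin L → 𝒳, g n q i k w = g n q i k w'

end PIRCode

/-!
The bound follows from the tightness of the converse proof of the capacity formula. Let the messages be independent and uniform, write `M` for
the entropy of one message, and `A n` for the answer of server `n` when message `0` is requested
with key `f`.

* The answers determine `W 0`, so `H(A) = M + c(f)` with `c(f) = H(A | W 0)`, while
  `H(A) ≤ ∑ n, H(A n) ≤ (∑ n, ℓ n) log |𝒴|`.
* `c(f) ≥ H(A n | W 0)` for each `n`, so `c(f)` is at least the average of `H(A n | W 0)` over the
  servers. By privacy the mean of `H(A n | W 0)` over the keys is the same when another message is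
  requested, and recovering the messages one after another gives
  `𝔼 c(f) ≥ 𝔼 (1/N) ∑ n, H(A n | W 0) ≥ M (1/N + ⋯ + 1/N^(K-1))`
  (`tailSum_mul_le_mean_condEntropy`).

For a capacity-achieving code the means of the outer terms agree, so that every inequality is an
equality for every single key: `(∑ n, ℓ n) log |𝒴| = M + c(f)`, and `H(A n | W 0) = c(f)` for all
`n`. The mean of `c` is positive, so some key has `c(f) > 0`. For this key no answer is empty,
because `0 < c(f) = H(A n | W 0) ≤ ℓ n log |𝒴|`; removing one server from the sum yields
`M = (∑ n, ℓ n) log |𝒴| - c(f) ≥ (N - 1) log |𝒴|`.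

Entropies are taken in nats, for functions on a finite sample space with the uniform distribution.
-/

/-! ### Conditional entropy on a finite uniform space -/

section Entropy

variable {Ω : Type*} [Fintype Ω] {α β γ δ : Type*}

open Classical in
/-- The number of points of `Ω` at which `f` takes the same value as at `x`. -/
noncomputable def fiberCard (f : Ω → α) (x : Ω) : ℕ :=
  (Finset.univ.filter fun y => f y = f x).card

/-- The conditional entropy `H(f | g)`, in nats, of functions on the finite set `Ω` with the
uniform distribution: the mean of `log (1 / Pr(f = f x | g = g x))`. The values of `f` and `g`
enter only through the partitions of `Ω` that they induce, so no structure is needed on the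
codomains. -/
noncomputable def condEntropy (f : Ω → α) (g : Ω → β) : ℝ :=
  (∑ x : Ω, Real.log ((fiberCard g x : ℝ) / fiberCard (fun y => (g y, f y)) x)) / Fintype.card Ω

theorem fiberCard_pos (f : Ω → α) (x : Ω) : (0 : ℝ) < fiberCard f x := by
  classical
  exact_mod_cast Finset.card_pos.mpr ⟨x, by simp⟩

theorem fiberCard_congr {f : Ω → α} {g : Ω → β} (h : ∀ x y, f x = f y ↔ g x = g y) (x : Ω) :
    fiberCard f x = fiberCard g x := by
  classical
  unfold fiberCard
  congr 1
  ext y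
  simp [h y x]

theorem fiberCard_eq_of_eq {f : Ω → α} {x y : Ω} (h : f x = f y) :
    fiberCard f x = fiberCard f y := by
  classical
  unfold fiberCard
  congr 1
  ext z
  simp [h]

theorem fiberCard_eq_card_filter (f : Ω → α) (x : Ω) [DecidablePred fun y => f y = f x] :
    fiberCard f x = (Finset.univ.filter fun y => f y = f x).card := by
  unfold fiberCard
  congr

theorem fiberCard_prod_le (g : Ω → β) (f : Ω → α) (x : Ω) :
    fiberCard (fun y => (g y, f y)) x ≤ fiberCard g x := by
  classical
  refine Finset.card_le_card fun y => ?_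
  simp +contextual

theorem fiberCard_const (c : β) (x : Ω) : fiberCard (fun _ : Ω => c) x = Fintype.card Ω := by
  simp [fiberCard]

theorem condEntropy_congr {f : Ω → α} {f' : Ω → γ} {g : Ω → β} {g' : Ω → δ}
    (hg : ∀ x y, g x = g y ↔ g' x = g' y)
    (hf : ∀ x y, g x = g y → (f x = f y ↔ f' x = f' y)) :
    condEntropy f g = condEntropy f' g' := by
  have h : ∀ x y, (g x, f x) = (g y, f y) ↔ (g' x, f' x) = (g' y, f' y) := by
    intro x y
    simp only [Prod.mk.injEq, ← hg]
    exact and_congr_right (hf x y)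
  simp only [condEntropy, fiberCard_congr hg, fiberCard_congr h]

theorem condEntropy_nonneg (f : Ω → α) (g : Ω → β) : 0 ≤ condEntropy f g := by
  refine div_nonneg (Finset.sum_nonneg fun x _ => Real.log_nonneg ?_) (Nat.cast_nonneg _)
  rw [one_le_div (fiberCard_pos _ _)]
  exact_mod_cast fiberCard_prod_le g f x

theorem condEntropy_prod (f : Ω → α) (h : Ω → γ) (g : Ω → β) :
    condEntropy (fun x => (f x, h x)) g =
      condEntropy f g + condEntropy h (fun x => (g x, f x)) := by
  unfold condEntropy
  rw [← add_div, ← Finset.sum_add_distrib]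
  congr 1
  refine Finset.sum_congr rfl fun x _ => ?_
  rw [Real.log_div (fiberCard_pos _ _).ne' (fiberCard_pos _ _).ne',
    Real.log_div (fiberCard_pos _ _).ne' (fiberCard_pos _ _).ne',
    Real.log_div (fiberCard_pos _ _).ne' (fiberCard_pos _ _).ne',
    fiberCard_congr (f := fun y => (g y, f y, h y)) (g := fun y => ((g y, f y), h y))
      (by simp [and_assoc])]
  ring

theorem condEntropy_eq_zero {f : Ω → α} {g : Ω → β} (h : ∀ x y, g x = g y → f x = f y) :
    condEntropy f g = 0 := by
  have : ∀ x, fiberCard (fun y => (g y, f y)) x = fiberCard g x :=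
    fiberCard_congr fun x y => by simpa using h x y
  simp only [condEntropy, this, div_self (fiberCard_pos _ _).ne']
  simp

theorem condEntropy_le_of_determines {f : Ω → α} {f' : Ω → γ} (g : Ω → β)
    (h : ∀ x y, f x = f y → f' x = f' y) : condEntropy f' g ≤ condEntropy f g := by
  have h1 : condEntropy f g = condEntropy (fun x => (f' x, f x)) g :=
    condEntropy_congr (fun _ _ => Iff.rfl) fun x y _ => by simpa using h x y
  rw [h1, condEntropy_prod]
  linarith [condEntropy_nonneg f fun x => (g x, f' x)]

/-- Conditioning on more information does not increase the entropy. -/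
theorem condEntropy_prod_le (f : Ω → α) (g : Ω → β) (h : Ω → γ) :
    condEntropy f (fun x => (g x, h x)) ≤ condEntropy f g := by
  classical
  set n1 : Ω → ℝ := fun x => fiberCard g x with hn1
  set n2 : Ω → ℝ := fun x => fiberCard (fun y => (g y, f y)) x with hn2
  set n3 : Ω → ℝ := fun x => fiberCard (fun y => (g y, h y)) x with hn3
  set n4 : Ω → ℝ := fun x => fiberCard (fun y => ((g y, h y), f y)) x with hn4
  have p1 : ∀ x, 0 < n1 x := fun x => fiberCard_pos _ x
  have p2 : ∀ x, 0 < n2 x := fun x => fiberCard_pos _ x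
  have p3 : ∀ x, 0 < n3 x := fun x => fiberCard_pos _ x
  have p4 : ∀ x, 0 < n4 x := fun x => fiberCard_pos _ x
  refine div_le_div_of_nonneg_right ?_ (Nat.cast_nonneg _)
  change ∑ x, Real.log (n3 x / n4 x) ≤ ∑ x, Real.log (n1 x / n2 x)
  -- By `log t ≤ t - 1` it is enough to bound the sum of the ratios by the size of `Ω`.
  have hlog : ∀ x, Real.log (n3 x / n4 x) - Real.log (n1 x / n2 x) ≤
      n3 x * n2 x / (n1 x * n4 x) - 1 := by
    intro x
    rw [← Real.log_div (div_pos (p3 x) (p4 x)).ne' (div_pos (p1 x) (p2 x)).ne']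
    have e : n3 x / n4 x / (n1 x / n2 x) = n3 x * n2 x / (n1 x * n4 x) := by
      have := p1 x; have := p2 x; have := p4 x
      field_simp
    rw [e]
    exact Real.log_le_sub_one_of_pos
      (div_pos (mul_pos (p3 x) (p2 x)) (mul_pos (p1 x) (p4 x)))
  -- Expand both numerators as sums of indicators, over `a` and `b`. For fixed `a` and `b` the
  -- points `x` that contribute form a single class of size `n4 x`, or none at all.
  have hexp : ∀ x, n3 x * n2 x / (n1 x * n4 x) =
      ∑ a : Ω, ∑ b : Ω, if (g a = g x ∧ h a = h x) ∧ (g b = g x ∧ f b = f x)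
        then 1 / (n1 x * n4 x) else 0 := by
    intro x
    have e3 : n3 x = ∑ a : Ω, if (g a = g x ∧ h a = h x) then (1 : ℝ) else 0 := by
      simp [hn3, fiberCard]
    have e2 : n2 x = ∑ b : Ω, if (g b = g x ∧ f b = f x) then (1 : ℝ) else 0 := by
      simp [hn2, fiberCard]
    rw [e3, e2, Finset.sum_mul_sum, div_eq_mul_one_div, Finset.sum_mul]
    refine Finset.sum_congr rfl fun a _ => ?_
    rw [Finset.sum_mul]
    refine Finset.sum_congr rfl fun b _ => ?_
    by_cases ha : g a = g x ∧ h a = h x <;> by_cases hb : g b = g x ∧ f b = f x <;> simp [ha, hb]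
  have hab : ∀ a b : Ω, (∑ x : Ω, if (g a = g x ∧ h a = h x) ∧ (g b = g x ∧ f b = f x)
        then 1 / (n1 x * n4 x) else 0) ≤ if g b = g a then 1 / n1 a else 0 := by
    intro a b
    by_cases hex : ∃ z, (g a = g z ∧ h a = h z) ∧ (g b = g z ∧ f b = f z)
    · obtain ⟨z, ⟨hz1, hz2⟩, hz3, hz4⟩ := hex
      rw [if_pos (hz3.trans hz1.symm)]
      have e : ∀ x, (if (g a = g x ∧ h a = h x) ∧ (g b = g x ∧ f b = f x)
          then 1 / (n1 x * n4 x) else 0) =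
          if ((g x, h x), f x) = ((g z, h z), f z) then 1 / (n1 a * n4 z) else 0 := by
        intro x
        have hiff : ((g a = g x ∧ h a = h x) ∧ (g b = g x ∧ f b = f x)) ↔
            ((g x, h x), f x) = ((g z, h z), f z) := by
          simp only [Prod.mk.injEq, hz1, hz2, hz3, hz4]
          constructor
          · rintro ⟨⟨h1, h2⟩, _, h4⟩
            exact ⟨⟨h1.symm, h2.symm⟩, h4.symm⟩
          · rintro ⟨⟨h1, h2⟩, h4⟩
            exact ⟨⟨h1.symm, h2.symm⟩, h1.symm, h4.symm⟩
        by_cases hx : ((g x, h x), f x) = ((g z, h z), f z)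
        · rw [if_pos hx, if_pos (hiff.mpr hx)]
          have q1 : n1 x = n1 a := by
            simp only [hn1]
            rw [fiberCard_eq_of_eq (hiff.mpr hx).1.1]
          have q4 : n4 x = n4 z := by
            simp only [hn4]
            rw [fiberCard_eq_of_eq (f := fun y => ((g y, h y), f y)) hx]
          rw [q1, q4]
        · rw [if_neg hx, if_neg (mt hiff.mp hx)]
      rw [Finset.sum_congr rfl fun x _ => e x, ← Finset.sum_filter, Finset.sum_const,
        nsmul_eq_mul, ← fiberCard_eq_card_filter (fun x => ((g x, h x), f x))]
      change n4 z * _ ≤ _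
      have := p1 a
      have := p4 z
      apply le_of_eq
      field_simp
    · push Not at hex
      rw [Finset.sum_eq_zero]
      · split_ifs
        · exact (one_div_pos.mpr (p1 a)).le
        · exact le_rfl
      · intro x _
        rw [if_neg]
        rintro ⟨h1, h2, h3⟩
        exact hex x h1 h2 h3
  have hsum : ∑ x, n3 x * n2 x / (n1 x * n4 x) ≤ ∑ _x : Ω, (1 : ℝ) := by
    simp only [hexp]
    rw [Finset.sum_comm]
    refine Finset.sum_le_sum fun a _ => ?_
    rw [Finset.sum_comm]
    refine (Finset.sum_le_sum fun b _ => hab a b).trans ?_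
    rw [← Finset.sum_filter, Finset.sum_const, nsmul_eq_mul]
    change n1 a * _ ≤ _
    rw [mul_one_div_cancel (p1 a).ne']
  have := Finset.sum_le_sum fun x (_ : x ∈ (Finset.univ : Finset Ω)) => hlog x
  rw [Finset.sum_sub_distrib, Finset.sum_sub_distrib] at this
  linarith

theorem condEntropy_le_condEntropy_const (f : Ω → α) (g : Ω → β) :
    condEntropy f g ≤ condEntropy f (fun _ => ()) := by
  refine le_of_eq_of_le (condEntropy_congr (g' := fun x => ((), g x)) ?_ ?_)
    (condEntropy_prod_le f (fun _ => ()) g) <;> simp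

theorem condEntropy_le_log_card [Fintype α] (f : Ω → α) (g : Ω → β) :
    condEntropy f g ≤ Real.log (Fintype.card α) := by
  classical
  refine (condEntropy_le_condEntropy_const f g).trans ?_
  rcases isEmpty_or_nonempty Ω with hΩ | ⟨⟨x₀⟩⟩
  · simpa [condEntropy] using Real.log_natCast_nonneg (Fintype.card α)
  have hΩ : (0 : ℝ) < Fintype.card Ω := by exact_mod_cast Fintype.card_pos_iff.mpr ⟨x₀⟩
  have hα : (0 : ℝ) < Fintype.card α := by exact_mod_cast Fintype.card_pos_iff.mpr ⟨f x₀⟩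
  rw [condEntropy, div_le_iff₀ hΩ]
  have hp : ∀ x, fiberCard (fun y => ((), f y)) x = fiberCard f x :=
    fiberCard_congr (by simp)
  simp only [hp, fiberCard_const]
  have hlog : ∀ x : Ω, Real.log ((Fintype.card Ω : ℝ) / fiberCard f x) ≤
      Real.log (Fintype.card α) +
        ((Fintype.card Ω : ℝ) / Fintype.card α * (1 / (fiberCard f x : ℝ)) - 1) := by
    intro x
    have hx := fiberCard_pos f x
    have e : (Fintype.card Ω : ℝ) / fiberCard f x =
        Fintype.card α * ((Fintype.card Ω : ℝ) / Fintype.card α * (1 / (fiberCard f x : ℝ))) := by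
      field_simp
    have hq : 0 < (Fintype.card Ω : ℝ) / Fintype.card α * (1 / (fiberCard f x : ℝ)) := by
      positivity
    rw [e, Real.log_mul hα.ne' hq.ne']
    linarith [Real.log_le_sub_one_of_pos hq]
  -- Each fibre contributes at most `1` to the sum of the reciprocals of the fibre sizes.
  have hrec : ∑ x : Ω, 1 / (fiberCard f x : ℝ) ≤ Fintype.card α := by
    rw [← Finset.sum_fiberwise_of_maps_to (g := f) (t := Finset.univ) fun _ _ => Finset.mem_univ _]
    have : ∀ a : α, ∑ x : Ω with f x = a, 1 / (fiberCard f x : ℝ) ≤ 1 := by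
      intro a
      have : ∀ x ∈ Finset.univ.filter (fun x : Ω => f x = a), 1 / (fiberCard f x : ℝ) =
          1 / ((Finset.univ.filter fun x : Ω => f x = a).card : ℝ) := by
        intro x hx
        simp only [fiberCard, (Finset.mem_filter.mp hx).2]
      rw [Finset.sum_congr rfl this, Finset.sum_const, nsmul_eq_mul, mul_one_div]
      exact div_self_le_one _
    refine (Finset.sum_le_sum fun a _ => this a).trans ?_
    simp
  refine (Finset.sum_le_sum fun x _ => hlog x).trans ?_
  rw [Finset.sum_add_distrib, Finset.sum_sub_distrib, ← Finset.mul_sum]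
  simp only [Finset.sum_const, Finset.card_univ, nsmul_eq_mul, mul_one]
  have h1 := mul_le_mul_of_nonneg_left hrec (div_pos hΩ hα).le
  rw [div_mul_cancel₀ _ hα.ne'] at h1
  linarith

theorem condEntropy_pi_le_sum {ι : Type*} [Fintype ι] {τ : ι → Type*} (A : ∀ i, Ω → τ i)
    (g : Ω → β) : condEntropy (fun x i => A i x) g ≤ ∑ i, condEntropy (A i) g := by
  classical
  have key : ∀ s : Finset ι, condEntropy (fun x (i : {i // i ∈ s}) => A i x) g ≤
      ∑ i ∈ s, condEntropy (A i) g := by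
    intro s
    induction s using Finset.induction_on with
    | empty =>
      rw [condEntropy_eq_zero fun x y _ => funext fun i => absurd i.2 (Finset.notMem_empty _)]
      simp
    | insert a s ha ih =>
      rw [Finset.sum_insert ha, condEntropy_congr (g' := g)
        (f' := fun x => ((fun (i : {i // i ∈ s}) => A i x), A a x)) (fun _ _ => Iff.rfl),
        condEntropy_prod]
      · linarith [condEntropy_prod_le (A a) g (fun x (i : {i // i ∈ s}) => A i x)]
      · intro x y _
        simp [funext_iff, and_comm]
  refine le_of_eq_of_le (condEntropy_congr (fun _ _ => Iff.rfl) ?_) (key Finset.univ)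
  intro x y _
  simp [funext_iff]

end Entropy

/-! ### Independent uniform messages -/

/-- The first `t` of the messages. -/
def firstMessages {K : ℕ} {μ : Type*} (t : ℕ) (W : Fin K → μ) : {k : Fin K // k.val < t} → μ :=
  fun k => W k

theorem firstMessages_eq_iff {K : ℕ} {μ : Type*} {t : ℕ} {W W' : Fin K → μ} :
    firstMessages t W = firstMessages t W' ↔ ∀ k : Fin K, k.val < t → W k = W' k := by
  simp [firstMessages, funext_iff]

theorem firstMessages_succ_eq_iff {K : ℕ} {μ : Type*} {k : Fin K} {W W' : Fin K → μ} :
    firstMessages (k.val + 1) W = firstMessages (k.val + 1) W' ↔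
      firstMessages k.val W = firstMessages k.val W' ∧ W k = W' k := by
  simp only [firstMessages_eq_iff]
  constructor
  · exact fun h => ⟨fun j hj => h j (by omega), h k (by omega)⟩
  · rintro ⟨h1, h2⟩ j hj
    rcases Nat.lt_succ_iff_lt_or_eq.mp hj with hj | hj
    · exact h1 j hj
    · rwa [Fin.ext hj]

theorem fiberCard_firstMessages {K : ℕ} {μ : Type*} [Fintype μ] (t : ℕ) (W : Fin K → μ) :
    fiberCard (firstMessages (K := K) (μ := μ) t) W =
      ∏ k : Fin K, if k.val < t then 1 else Fintype.card μ := by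
  classical
  have : (Finset.univ.filter fun W' : Fin K → μ => firstMessages t W' = firstMessages t W) =
      Fintype.piFinset fun k : Fin K => if k.val < t then {W k} else Finset.univ := by
    ext W'
    simp only [Finset.mem_filter, Finset.mem_univ, true_and, firstMessages_eq_iff,
      Fintype.mem_piFinset]
    refine forall_congr' fun k => ?_
    by_cases hk : k.val < t <;> simp [hk]
  rw [fiberCard_eq_card_filter, this, Fintype.card_piFinset]
  refine Finset.prod_congr rfl fun k _ => ?_
  by_cases hk : k.val < t <;> simp [hk]

/-- A message is uniformly distributed and independent of the preceding ones. -/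
theorem condEntropy_message {K : ℕ} {μ : Type*} [Fintype μ] [Nonempty μ] (k : Fin K) :
    condEntropy (fun W : Fin K → μ => W k) (firstMessages k.val) =
      Real.log (Fintype.card μ) := by
  classical
  have h : ∀ W : Fin K → μ, (fiberCard (firstMessages k.val) W : ℝ) /
      fiberCard (fun W' : Fin K → μ => (firstMessages k.val W', W' k)) W = Fintype.card μ := by
    intro W
    have hsucc : fiberCard (fun W' : Fin K → μ => (firstMessages k.val W', W' k)) W =
        fiberCard (firstMessages (k.val + 1)) W :=
      fiberCard_congr (fun W₁ W₂ => by
        rw [Prod.mk.injEq]; exact firstMessages_succ_eq_iff.symm) W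
    rw [hsucc, div_eq_iff (fiberCard_pos _ _).ne', fiberCard_firstMessages, fiberCard_firstMessages,
      ← Finset.mul_prod_erase _ _ (Finset.mem_univ k),
      ← Finset.mul_prod_erase _ (fun j : Fin K => if j.val < k.val + 1 then 1
        else Fintype.card μ) (Finset.mem_univ k)]
    simp only [lt_irrefl, if_false, Nat.lt_succ_self, if_true, one_mul, Nat.cast_mul]
    congr 2
    refine Finset.prod_congr rfl fun j hj => ?_
    have : j.val ≠ k.val := fun e => (Finset.mem_erase.mp hj).1 (Fin.ext e)
    have hiff : j.val < k.val ↔ j.val < k.val + 1 := by omega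
    simp only [hiff]
  simp only [condEntropy, h]
  rw [Finset.sum_const, nsmul_eq_mul, Finset.card_univ, mul_div_cancel_left₀]
  exact_mod_cast Fintype.card_ne_zero

/-! ### The converse bound for private information retrieval -/

namespace PIRCode

variable {N K L : ℕ} {𝒳 𝒴 𝓕 : Type*} [Fintype 𝓕] {𝒬 : Fin N → Type*}

/-- Privacy, for the mean over the keys of a function of the query to one server. -/
theorem sum_query_eq_sum_query [Nonempty 𝓕] (C : PIRCode N K L 𝒳 𝒴 𝓕 𝒬) (k k' : Fin K)
    (n : Fin N) (u : 𝒬 n → ℝ) : ∑ f, u (C.query n k f) = ∑ f, u (C.query n k' f) := by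
  classical
  have hF : (Fintype.card 𝓕 : ℝ) ≠ 0 := by exact_mod_cast Fintype.card_ne_zero
  have key : ∀ (j : Fin K) (s : Finset (𝒬 n)), (∀ f, C.query n j f ∈ s) →
      ∑ f, u (C.query n j f) =
        ∑ q ∈ s, keyProb {f : 𝓕 | C.query n j f = q} * Fintype.card 𝓕 * u q := by
    intro j s hs
    rw [← Finset.sum_fiberwise_of_maps_to (fun f _ => hs f)]
    refine Finset.sum_congr rfl fun q _ => ?_
    have h1 : ∑ f : 𝓕 with C.query n j f = q, u (C.query n j f) =
        ∑ f : 𝓕 with C.query n j f = q, u q :=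
      Finset.sum_congr rfl fun f hf => by rw [(Finset.mem_filter.mp hf).2]
    have h2 : {f : 𝓕 | C.query n j f = q}.ncard =
        (Finset.univ.filter fun f : 𝓕 => C.query n j f = q).card := by
      rw [← Set.ncard_coe_finset]
      simp
    rw [h1, Finset.sum_const, nsmul_eq_mul, keyProb, h2, div_mul_cancel₀ _ hF]
  rw [key k (Finset.univ.image (C.query n k) ∪ Finset.univ.image (C.query n k')) (by simp),
    key k' (Finset.univ.image (C.query n k) ∪ Finset.univ.image (C.query n k')) (by simp)]
  simp only [C.privacy k k' n]

/-- All the answers, as a function of the messages, when message `k` is requested with key `f`. -/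
def answers (C : PIRCode N K L 𝒳 𝒴 𝓕 𝒬) (k : Fin K) (f : 𝓕) (W : Fin K → Fin L → 𝒳) :
    ∀ n : Fin N, Fin (C.len n (C.query n k f)) → 𝒴 :=
  fun n => C.answer n (C.query n k f) W

theorem message_eq_of_answers_eq (C : PIRCode N K L 𝒳 𝒴 𝓕 𝒬) (k : Fin K) (f : 𝓕)
    {W W' : Fin K → Fin L → 𝒳} (h : C.answers k f W = C.answers k f W') : W k = W' k := by
  rw [← C.correct k f W, ← C.correct k f W']
  exact congrArg (C.reconstruct k f) h

variable [Fintype 𝒳]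

/-- The answers carry the requested message, and the interference that remains once this message
is known. -/
theorem condEntropy_answers [Nonempty 𝒳] (C : PIRCode N K L 𝒳 𝒴 𝓕 𝒬) (k : Fin K) (f : 𝓕) :
    condEntropy (C.answers k f) (firstMessages k.val) =
      L * Real.log (Fintype.card 𝒳) +
        condEntropy (C.answers k f) (firstMessages (k.val + 1)) := by
  classical
  have h1 : condEntropy (C.answers k f) (firstMessages k.val) =
      condEntropy (fun W => (W k, C.answers k f W)) (firstMessages k.val) :=
    condEntropy_congr (fun _ _ => Iff.rfl) fun W W' _ => by
      simpa using C.message_eq_of_answers_eq k f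
  have h2 : condEntropy (C.answers k f) (firstMessages (k.val + 1)) =
      condEntropy (C.answers k f) (fun W => (firstMessages k.val W, W k)) :=
    condEntropy_congr (fun W W' => by rw [Prod.mk.injEq]; exact firstMessages_succ_eq_iff)
      fun _ _ _ => Iff.rfl
  rw [h1, condEntropy_prod, condEntropy_message, h2]
  simp [Real.log_pow]

theorem condEntropy_answer_le_answers {β : Type*} (C : PIRCode N K L 𝒳 𝒴 𝓕 𝒬) (k : Fin K)
    (f : 𝓕) (n : Fin N) (g : (Fin K → Fin L → 𝒳) → β) :
    condEntropy (C.answer n (C.query n k f)) g ≤ condEntropy (C.answers k f) g :=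
  condEntropy_le_of_determines g fun _ _ h => congrFun h n

theorem condEntropy_answers_le_sum {β : Type*} (C : PIRCode N K L 𝒳 𝒴 𝓕 𝒬) (k : Fin K)
    (f : 𝓕) (g : (Fin K → Fin L → 𝒳) → β) :
    condEntropy (C.answers k f) g ≤ ∑ n, condEntropy (C.answer n (C.query n k f)) g :=
  condEntropy_pi_le_sum (fun n => C.answer n (C.query n k f)) g

theorem condEntropy_answer_le_len [Fintype 𝒴] {β : Type*} (C : PIRCode N K L 𝒳 𝒴 𝓕 𝒬)
    (n : Fin N) (q : 𝒬 n) (g : (Fin K → Fin L → 𝒳) → β) :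
    condEntropy (C.answer n q) g ≤ C.len n q * Real.log (Fintype.card 𝒴) := by
  refine (condEntropy_le_log_card _ g).trans (le_of_eq ?_)
  simp [Real.log_pow]

/-- Given the messages up to the requested one, the entropies of the single answers satisfy the
lower bound of the converse: with `r` messages left unknown, their sum is on average at least
`1 + 1/N + ⋯ + 1/N^(r-1)` message entropies. Each step of the induction requests the next message
instead, which by privacy does not change the mean for a single server. -/
theorem tailSum_mul_le_mean_condEntropy [Nonempty 𝒳] [Nonempty 𝓕] (hN : 0 < N)
    (C : PIRCode N K L 𝒳 𝒴 𝓕 𝒬) (r : ℕ) (k : Fin K) (hr : k.val + 1 + r = K) :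
    Fintype.card 𝓕 * ((L * Real.log (Fintype.card 𝒳)) *
        ∑ i ∈ Finset.range r, (1 / (N : ℝ)) ^ i) ≤
      ∑ f : 𝓕, ∑ n : Fin N,
        condEntropy (C.answer n (C.query n k f)) (firstMessages (k.val + 1)) := by
  induction r generalizing k with
  | zero =>
    simp only [Finset.range_zero, Finset.sum_empty, mul_zero]
    exact Finset.sum_nonneg fun f _ => Finset.sum_nonneg fun n _ => condEntropy_nonneg _ _
  | succ r ih =>
    have hN' : (0 : ℝ) < N := by exact_mod_cast hN
    let k' : Fin K := ⟨k.val + 1, by omega⟩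
    have hk' := ih k' (by simp only [k']; omega)
    rw [Finset.sum_comm]
    rw [Finset.sum_congr rfl fun n _ => C.sum_query_eq_sum_query k k' n
      fun q => condEntropy (C.answer n q) (firstMessages (k.val + 1)), Finset.sum_comm]
    have hf : ∀ f, L * Real.log (Fintype.card 𝒳) + (1 / (N : ℝ)) *
        ∑ n, condEntropy (C.answer n (C.query n k' f)) (firstMessages (k'.val + 1)) ≤
        ∑ n, condEntropy (C.answer n (C.query n k' f)) (firstMessages (k.val + 1)) := by
      intro f
      have h1 := C.condEntropy_answers_le_sum k' f (firstMessages (k.val + 1))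
      have h2 := C.condEntropy_answers k' f
      have h3 : (1 / (N : ℝ)) *
          ∑ n, condEntropy (C.answer n (C.query n k' f)) (firstMessages (k'.val + 1)) ≤
          condEntropy (C.answers k' f) (firstMessages (k'.val + 1)) := by
        have := Finset.sum_le_sum fun n (_ : n ∈ (Finset.univ : Finset (Fin N))) =>
          C.condEntropy_answer_le_answers k' f n (firstMessages (k'.val + 1))
        rw [one_div, inv_mul_le_iff₀ hN']
        simpa using this
      change condEntropy _ (firstMessages k'.val) ≤ _ at h1
      change _ ≤ ∑ n, condEntropy _ (firstMessages k'.val)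
      linarith
    refine le_trans ?_ (Finset.sum_le_sum fun f _ => hf f)
    rw [Finset.sum_add_distrib, ← Finset.mul_sum, Finset.sum_const, nsmul_eq_mul,
      Finset.card_univ]
    have h4 := mul_le_mul_of_nonneg_left hk' (one_div_pos.mpr hN').le
    rw [Finset.sum_range_succ']
    simp only [pow_succ, ← Finset.sum_mul, pow_zero]
    rw [← Finset.mul_sum]
    linarith

/-- The total download over all keys, in nats, of a code whose rate is the capacity. -/
theorem sum_len_eq_of_isCapacityAchieving [Fintype 𝒴] [Nonempty 𝓕] (hN : 0 < N) (hK : 0 < K)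
    (C : PIRCode N K L 𝒳 𝒴 𝓕 𝒬) (hcap : C.IsCapacityAchieving) (k : Fin K) :
    Real.log (Fintype.card 𝒴) * ∑ f, ∑ n, (C.len n (C.query n k f) : ℝ) =
      Fintype.card 𝓕 * ((L * Real.log (Fintype.card 𝒳)) *
        ∑ i ∈ Finset.range K, (1 / (N : ℝ)) ^ i) := by
  obtain ⟨hpos, hrate⟩ := hcap k
  have hN' : (0 : ℝ) < N := by exact_mod_cast hN
  have hF : (Fintype.card 𝓕 : ℝ) ≠ 0 := by exact_mod_cast Fintype.card_ne_zero
  have hS : (0 : ℝ) < ∑ i ∈ Finset.range K, (1 / (N : ℝ)) ^ i :=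
    Finset.sum_pos (fun i _ => by positivity) ⟨0, by simpa using hK⟩
  have hl2 : Real.log 2 ≠ 0 := (Real.log_pos one_lt_two).ne'
  rw [rate, div_eq_iff hpos.ne', capacity, inv_mul_eq_div, eq_div_iff hS.ne', downloadCost,
    messageSize, Real.logb, Real.logb] at hrate
  simp only [expectedLength] at hrate
  rw [← Finset.sum_div, Finset.sum_comm] at hrate
  field_simp at hrate
  linarith

end PIRCode

theorem theorem3 {N K L : ℕ} (hK : 2 ≤ K) {𝒳 𝒴 𝓕 : Type*} [Fintype 𝒳] [Fintype 𝒴]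
    [AddCommGroup 𝒴] [Fintype 𝓕] [Nonempty 𝓕] {𝒬 : Fin N → Type*}
    (C : PIRCode N K L 𝒳 𝒴 𝓕 𝒬)
    (hdec : C.IsUniformlyDecomposable) (hcap : C.IsCapacityAchieving) :
    ((N : ℝ) - 1) * Real.logb 2 (Fintype.card 𝒴 : ℝ) ≤ C.messageSize ∧
      (N : ℝ) - 1 ≤ C.messageSize := by
  classical
  let k₀ : Fin K := ⟨0, by omega⟩
  obtain ⟨hpos, hrate⟩ := hcap k₀
  have hN : 0 < N := by
    rcases Nat.eq_zero_or_pos N with rfl | h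
    · simp [PIRCode.downloadCost] at hpos
    · exact h
  have hN' : (0 : ℝ) < N := by exact_mod_cast hN
  have hN1 : (1 : ℝ) ≤ N := by exact_mod_cast hN
  have hl2 : 0 < Real.log 2 := Real.log_pos one_lt_two
  have hY : 2 ≤ Fintype.card 𝒴 := by
    have h1 : Fintype.card 𝒴 ≠ 0 := Fintype.card_ne_zero
    have h2 : Fintype.card 𝒴 ≠ 1 := by
      intro h
      simp [PIRCode.downloadCost, h] at hpos
    omega
  have hYlog : Real.log 2 ≤ Real.log (Fintype.card 𝒴) :=
    Real.log_le_log two_pos (by exact_mod_cast hY)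
  set y := Real.log (Fintype.card 𝒴) with hy
  set M := (L : ℝ) * Real.log (Fintype.card 𝒳) with hM
  have hMsize : C.messageSize = M / Real.log 2 := by
    rw [PIRCode.messageSize, Real.logb, hM, mul_div_assoc]
  have hMpos : 0 < M := by
    have hS : (0 : ℝ) < ∑ i ∈ Finset.range K, (1 / (N : ℝ)) ^ i :=
      Finset.sum_pos (fun i _ => by positivity) ⟨0, by simp; omega⟩
    have h1 : 0 < C.messageSize := by
      rw [PIRCode.rate, div_eq_iff hpos.ne'] at hrate
      rw [hrate, PIRCode.capacity]
      exact mul_pos (inv_pos.mpr hS) hpos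
    rw [hMsize] at h1
    exact (div_pos_iff_of_pos_right hl2).mp h1
  have : Nonempty 𝒳 := by
    rw [← not_isEmpty_iff]
    intro h
    simp [hM] at hMpos
  suffices hmain : ((N : ℝ) - 1) * y ≤ M by
    have h1 : ((N : ℝ) - 1) * Real.logb 2 (Fintype.card 𝒴 : ℝ) ≤ C.messageSize := by
      rw [hMsize, Real.logb, ← mul_div_assoc]
      exact div_le_div_of_nonneg_right hmain hl2.le
    refine ⟨h1, le_trans (le_mul_of_one_le_right (by linarith) ?_) h1⟩
    rwa [Real.logb, le_div_iff₀ hl2, one_mul]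
  -- For each key: the number of downloaded nats, the interference in all answers, and the average
  -- interference in a single answer.
  let len : 𝓕 → ℝ := fun f => ∑ n, (C.len n (C.query n k₀ f) : ℝ)
  let c : 𝓕 → ℝ := fun f => condEntropy (C.answers k₀ f) (firstMessages (k₀.val + 1))
  let d : 𝓕 → Fin N → ℝ := fun f n =>
    condEntropy (C.answer n (C.query n k₀ f)) (firstMessages (k₀.val + 1))
  have hdc : ∀ f n, d f n ≤ c f := fun f n => C.condEntropy_answer_le_answers k₀ f n _
  have hsum : ∀ f, ∑ n, d f n ≤ N * c f := fun f => by
    simpa using Finset.sum_le_sum fun n (_ : n ∈ (Finset.univ : Finset (Fin N))) => hdc f n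
  have hcost : ∀ f, M + c f ≤ y * len f := by
    intro f
    have h1 := C.condEntropy_answers k₀ f
    have h2 := C.condEntropy_answers_le_sum k₀ f (firstMessages k₀.val)
    have h3 := Finset.sum_le_sum fun n (_ : n ∈ (Finset.univ : Finset (Fin N))) =>
      C.condEntropy_answer_le_len n (C.query n k₀ f) (firstMessages k₀.val)
    rw [← Finset.sum_mul, mul_comm] at h3
    change _ = M + c f at h1
    change _ ≤ y * len f at h3
    linarith
  have hK1 : K - 1 + 1 = K := by omega
  set S := ∑ i ∈ Finset.range (K - 1), (1 / (N : ℝ)) ^ i with hS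
  have hSpos : 0 < S := Finset.sum_pos (fun i _ => by positivity) ⟨0, by simp; omega⟩
  have hlow : Fintype.card 𝓕 * (M * S) ≤ ∑ f, ∑ n, d f n :=
    C.tailSum_mul_le_mean_condEntropy hN (K - 1) k₀ (by simp only [k₀]; omega)
  have htotal : y * ∑ f, len f = Fintype.card 𝓕 * (M * (1 + 1 / N * S)) := by
    have h : ∑ i ∈ Finset.range K, (1 / (N : ℝ)) ^ i = 1 + 1 / N * S := by
      rw [← hK1, Finset.sum_range_succ']
      simp only [pow_succ, ← Finset.sum_mul, pow_zero]
      rw [← hS]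
      ring
    rw [← h]
    exact C.sum_len_eq_of_isCapacityAchieving hN (by omega) hcap k₀
  -- The total slack over all keys is not positive, so all the inequalities are equalities.
  have hslack : ∑ f, ((y * len f - M - c f) + (c f - 1 / N * ∑ n, d f n)) ≤ 0 := by
    have e : ∀ f, (y * len f - M - c f) + (c f - 1 / N * ∑ n, d f n) =
        y * len f - M - 1 / N * ∑ n, d f n := fun f => by ring
    rw [Finset.sum_congr rfl fun f _ => e f, Finset.sum_sub_distrib, Finset.sum_sub_distrib,
      ← Finset.mul_sum, ← Finset.mul_sum (f := fun f => ∑ n, d f n), htotal, Finset.sum_const, nsmul_eq_mul,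
      Finset.card_univ]
    have := mul_le_mul_of_nonneg_left hlow (one_div_pos.mpr hN').le
    linarith
  have hs1 : ∀ f, 0 ≤ y * len f - M - c f := fun f => by linarith [hcost f]
  have hs2 : ∀ f, 0 ≤ c f - 1 / N * ∑ n, d f n := fun f => by
    rw [sub_nonneg, one_div, inv_mul_le_iff₀ hN']
    exact hsum f
  have htight : ∀ f, (y * len f - M - c f) + (c f - 1 / N * ∑ n, d f n) = 0 := by
    have h0 := le_antisymm hslack (Finset.sum_nonneg fun f _ => add_nonneg (hs1 f) (hs2 f))
    intro f
    exact (Finset.sum_eq_zero_iff_of_nonneg fun f _ => add_nonneg (hs1 f) (hs2 f)).mp h0 f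
      (Finset.mem_univ f)
  -- A key with interference exists, since the mean of the interference is positive.
  obtain ⟨f, -, hf⟩ : ∃ f ∈ (Finset.univ : Finset 𝓕), 0 < ∑ n, d f n := by
    by_contra! hcon
    have := Finset.sum_nonpos hcon
    have : 0 < Fintype.card 𝓕 * (M * S) := by positivity
    linarith
  have hcf : y * len f = M + c f := by linarith [hs1 f, hs2 f, htight f]
  have hdf : ∑ n, d f n = ∑ _n : Fin N, c f := by
    have h : 1 / N * ∑ n, d f n = c f := by linarith [hs1 f, hs2 f, htight f]
    rw [Finset.sum_const, Finset.card_univ, Fintype.card_fin, nsmul_eq_mul, ← h, one_div,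
      mul_inv_cancel_left₀ hN'.ne']
  have hd : ∀ n, d f n = c f := fun n =>
    (Finset.sum_eq_sum_iff_of_le fun n _ => hdc f n).mp hdf n (Finset.mem_univ n)
  have hcpos : 0 < c f := by
    simp only [hd, Finset.sum_const, Finset.card_univ, Fintype.card_fin, nsmul_eq_mul] at hf
    exact pos_of_mul_pos_right hf hN'.le
  have hlen : ∀ n, c f ≤ C.len n (C.query n k₀ f) * y := fun n =>
    (hd n).symm.le.trans (C.condEntropy_answer_le_len n _ _)
  have hlen1 : ∀ n, (1 : ℝ) ≤ C.len n (C.query n k₀ f) := by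
    intro n
    have : C.len n (C.query n k₀ f) ≠ 0 := by
      intro h0
      have := hlen n
      rw [h0] at this
      simp only [Nat.cast_zero, zero_mul] at this
      linarith
    exact_mod_cast Nat.one_le_iff_ne_zero.mpr this
  let n₀ : Fin N := ⟨0, hN⟩
  have hsplit : len f = C.len n₀ (C.query n₀ k₀ f) +
      ∑ n ∈ Finset.univ.erase n₀, (C.len n (C.query n k₀ f) : ℝ) :=
    (Finset.add_sum_erase _ _ (Finset.mem_univ n₀)).symm
  have hrest : (N : ℝ) - 1 ≤ ∑ n ∈ Finset.univ.erase n₀, (C.len n (C.query n k₀ f) : ℝ) := by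
    have := Finset.sum_le_sum fun n (_ : n ∈ Finset.univ.erase n₀) => hlen1 n
    simpa [Finset.card_erase_of_mem, Nat.cast_sub hN] using this
  have hrest' := mul_le_mul_of_nonneg_right hrest (hl2.le.trans hYlog)
  rw [hsplit, mul_add] at hcf
  linarith [hlen n₀]
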